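/- For an abelian group $G$, a sequence $(u_n)_{n\ge 0}$ in $G$ is called a $T$-sequence if there is a Hausdorff group topology on $G$ in which $u_n$ converges to the neutral element. For a compact abelian group $X$ with dual group $\widehat{X}$ (the group of all continuous characters $X\to\{z\in\mathbb{C}: |z|=1\}$) and a sequence $\mathbf{u}=(u_n)_{n\ge 0}$ in $\widehat{X}$, put $s_{\mathbf{u}}(X)=\{x\in X : u_n(x)\to 1\}$, which is a subgroup of $X$. A subgroup $H$ of $X$ is called characterized if $H=s_{\mathbf{u}}(X)$ for some sequence $\mathbf{u}$ in $\widehat{X}$, and $T$-characterized if $H=s_{\mathbf{u}}(X)$ for some $T$-sequence $\mathbf{u}$ in $\widehat{X}$. Let $\mathrm{Char}(X)$ and $\mathrm{Char}_T(X)$ denote the sets of all characterized and of all $T$-characterized subgroups of $X$, respectively. **Proposition.** For the circle group $\mathbb{T}=\{z\in\mathbb{C}: |z|=1\}$, every characterized subgroup is $T$-characterized; that is, $$\mathrm{Char}_T(\mathbb{T})=\mathrm{Char}(\mathbb{T}).$$ -/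

import Mathlib

open Filter Topology

/-- A sequence `u` in an abelian group `G` is a `T`-sequence if there is a Hausdorff group topology
on `G` in which `u` converges to the neutral element. -/
def IsTSequence {G : Type*} [CommGroup G] (u : ℕ → G) : Prop :=
  ∃ τ : GroupTopology G, @T2Space G τ.toTopologicalSpace ∧
    Tendsto u atTop (@nhds G τ.toTopologicalSpace 1)

/-- For a sequence `u` of continuous characters of an abelian topological group `X`, the subgroup
`s_u(X)` of all `x` in `X` such that `u n x` tends to `1`. -/
def sSubgroup {X : Type*} [CommGroup X] [TopologicalSpace X] (u : ℕ → PontryaginDual X) :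
    Subgroup X where
  carrier := {x | Tendsto (fun n => u n x) atTop (𝓝 (1 : Circle))}
  one_mem' := by simp
  mul_mem' {x y} hx hy := by
    have h := Tendsto.mul (Set.mem_ofPred_eq ▸ hx) (Set.mem_ofPred_eq ▸ hy)
    simpa using h
  inv_mem' {x} hx := by
    have h := Tendsto.inv (Set.mem_ofPred_eq ▸ hx)
    simpa using h

/-- `Char(X)`: the set of all characterized subgroups of `X`, that is, of the subgroups of the form
`s_u(X)` for some sequence `u` in the dual group of `X`. -/
def charSubgroups (X : Type*) [CommGroup X] [TopologicalSpace X] : Set (Subgroup X) :=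
  {H | ∃ u : ℕ → PontryaginDual X, H = sSubgroup u}

/-- `Char_T(X)`: the set of all `T`-characterized subgroups of `X`, that is, of the subgroups of the
form `s_u(X)` for some `T`-sequence `u` in the dual group of `X`. -/
def tCharSubgroups (X : Type*) [CommGroup X] [TopologicalSpace X] : Set (Subgroup X) :=
  {H | ∃ u : ℕ → PontryaginDual X, IsTSequence u ∧ H = sSubgroup u}

/-! An infinite subgroup of the circle is dense, so characters are separated by their values on it.
If `s_u` is infinite, pointwise convergence on it is a Hausdorff group topology in which `u` tends
to `1`.

A finite subgroup of order `m` is the group of `m`-th roots of unity. It suffices to find integers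
`v n`, null for some norm on `ℤ`, such that `z ^ v n → 1` forces `z = 1`; then `(z ^ m) ^ v n`
characterizes the subgroup, and the norm passes to the infinite cyclic group of powers of `z ↦ z ^
m`.

The norm is the infimum of a decreasing sequence. Stage `n` takes very sparse `g 0, …, g n` with sum
`1` and makes the numbers `2 ^ r * g i` cheap (`AddGroupNorm.exists_smaller`). Sparseness means that
a short integer gains only from combinations with equal coefficients; these use all `n + 1` terms at
price at least `1 / (n + 1)` each, so values below `1` survive. If all `z ^ (2 ^ r * g i)` are near
`1`, then each `z ^ g i` is very near `1`, and so is their product `z`. -/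

/-! ### Sparse families of integers. -/

theorem exists_lacunary (n : ℕ) (L M : ℤ) :
    ∃ g : Fin n → ℤ, ∀ e : Fin n → ℤ, (∀ i, |e i| ≤ L) → |∑ i, e i * g i| ≤ M → e = 0 := by
  induction n with
  | zero => exact ⟨0, fun e _ _ => Subsingleton.elim _ _⟩
  | succ n ih =>
    obtain ⟨g, hg⟩ := ih
    set S : ℤ := ∑ i, |g i|
    -- The new term exceeds `M` plus anything the tail can cancel, so its coefficient must vanish.
    refine ⟨Fin.cons (|M| + |L| * S + 1) g, fun e he hs => ?_⟩
    rw [Fin.sum_univ_succ] at hs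
    simp only [Fin.cons_zero, Fin.cons_succ] at hs
    have htail : |∑ i : Fin n, e i.succ * g i| ≤ |L| * S := by
      refine (Finset.abs_sum_le_sum_abs _ _).trans ?_
      rw [Finset.mul_sum]
      refine Finset.sum_le_sum fun i _ => ?_
      rw [abs_mul]
      exact mul_le_mul_of_nonneg_right ((he _).trans (le_abs_self L)) (abs_nonneg _)
    have hS : 0 ≤ |L| * S := mul_nonneg (abs_nonneg _) (Finset.sum_nonneg fun i _ => abs_nonneg _)
    have h0 : e 0 = 0 := by
      by_contra h
      have h1 : 1 ≤ |e 0| := Int.one_le_abs h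
      have h2 : |e 0 * (|M| + |L| * S + 1)| ≤ M + |L| * S := by
        have h3 := abs_add_le (e 0 * (|M| + |L| * S + 1) + ∑ i : Fin n, e i.succ * g i)
          (-∑ i : Fin n, e i.succ * g i)
        rw [add_neg_cancel_right, abs_neg] at h3
        linarith
      have h4 : 0 < |M| + |L| * S + 1 := by positivity
      rw [abs_mul, abs_of_pos h4] at h2
      nlinarith [le_abs_self M]
    rw [h0, zero_mul, zero_add] at hs
    have := hg (fun i => e i.succ) (fun i => he _) hs
    funext i
    refine Fin.cases h0 (fun j => congrFun this j) i

/-- The first term is chosen to make the sum `1`. Subtracting `j 0` times that sum leaves a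
combination of the sparse tail with coefficients `j i.succ - j 0`, whence the bounds `2 * L` and `M
+ L`. -/
theorem exists_lacunary_sum_eq_one (n : ℕ) (L M : ℤ) :
    ∃ g : Fin (n + 1) → ℤ, ∑ i, g i = 1 ∧ ∀ j : Fin (n + 1) → ℤ, (∀ i, |j i| ≤ L) →
      |∑ i, j i * g i| ≤ M → ∀ i, j i = j 0 := by
  obtain ⟨g, hg⟩ := exists_lacunary n (2 * L) (M + L)
  refine ⟨Fin.cons (1 - ∑ i, g i) g, by simp [Fin.sum_univ_succ], fun j hj hs => ?_⟩
  have he := hg (fun i => j i.succ - j 0) (fun i => ?_) ?_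
  · refine Fin.cases rfl fun i => ?_
    have := congrFun he i
    simp only [Pi.zero_apply] at this
    omega
  · have h1 := hj i.succ
    have h2 := hj 0
    have := abs_sub (j i.succ) (j 0)
    linarith
  · have h1 : ∑ i, (j i.succ - j 0) * g i
        = (∑ i, j i * (Fin.cons (1 - ∑ i, g i) g : Fin (n + 1) → ℤ) i) - j 0 := by
      simp only [Fin.sum_univ_succ, Fin.cons_zero, Fin.cons_succ, sub_mul, Finset.sum_sub_distrib,
        ← Finset.mul_sum]
      ring
    rw [h1]
    have := abs_sub (∑ i, j i * (Fin.cons (1 - ∑ i, g i) g : Fin (n + 1) → ℤ) i) (j 0)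
    have := hj 0
    linarith

/-! ### Norms on the integers. -/

namespace AddGroupNorm

/-- The cost of writing `x` as an integral combination of the `g i` with coefficients `j` up to an
error, where errors are measured by `ℓ` and coefficients by `φ`. -/
def cost {ι : Type*} [Fintype ι] (ℓ φ : AddGroupNorm ℤ) (g : ι → ℤ) (x : ℤ) (j : ι → ℤ) : ℝ :=
  ℓ (x - ∑ i, j i * g i) + ∑ i, φ (j i)

section cost

variable {ι : Type*} [Fintype ι] (ℓ φ : AddGroupNorm ℤ) (g : ι → ℤ)

theorem cost_nonneg (x : ℤ) (j : ι → ℤ) : 0 ≤ ℓ.cost φ g x j :=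
  add_nonneg (apply_nonneg _ _) (Finset.sum_nonneg fun _ _ => apply_nonneg _ _)

theorem bddBelow_cost (x : ℤ) : BddBelow (Set.range (ℓ.cost φ g x)) :=
  ⟨0, by rintro _ ⟨j, rfl⟩; exact cost_nonneg ..⟩

theorem cost_zero (x : ℤ) : ℓ.cost φ g x 0 = ℓ x := by simp [cost]

theorem cost_add_le (x y : ℤ) (j k : ι → ℤ) :
    ℓ.cost φ g (x + y) (j + k) ≤ ℓ.cost φ g x j + ℓ.cost φ g y k := by
  have h1 : x + y - ∑ i, (j + k) i * g i = (x - ∑ i, j i * g i) + (y - ∑ i, k i * g i) := by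
    simp only [Pi.add_apply, add_mul, Finset.sum_add_distrib]
    ring
  have h2 : ∑ i, φ ((j + k) i) ≤ ∑ i, φ (j i) + ∑ i, φ (k i) := by
    rw [← Finset.sum_add_distrib]
    exact Finset.sum_le_sum fun i _ => map_add_le_add _ _ _
  have h3 := map_add_le_add ℓ (x - ∑ i, j i * g i) (y - ∑ i, k i * g i)
  unfold cost
  rw [h1]
  linarith

theorem cost_neg (x : ℤ) (j : ι → ℤ) : ℓ.cost φ g (-x) (-j) = ℓ.cost φ g x j := by
  have h1 : -x - ∑ i, (-j) i * g i = -(x - ∑ i, j i * g i) := by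
    simp only [Pi.neg_apply, neg_mul, Finset.sum_neg_distrib]
    ring
  unfold cost
  rw [h1, map_neg_eq_map]
  simp [map_neg_eq_map]

/-- A single nonzero coefficient already costs `c`. This keeps the infimum of the costs positive at
nonzero integers. -/
theorem min_le_cost {c : ℝ} (hφ : ∀ j, j ≠ 0 → c ≤ φ j) (x : ℤ) (j : ι → ℤ) :
    min (ℓ x) c ≤ ℓ.cost φ g x j := by
  by_cases hj : j = 0
  · rw [hj, cost_zero]
    exact min_le_left _ _
  · obtain ⟨i, hi⟩ := Function.ne_iff.mp hj
    have h1 := Finset.single_le_sum (f := fun i => φ (j i)) (fun i _ => apply_nonneg φ (j i))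
      (Finset.mem_univ i)
    have h2 := hφ _ hi
    have h3 := apply_nonneg ℓ (x - ∑ i, j i * g i)
    refine (min_le_right _ _).trans ?_
    unfold cost
    linarith

/-- The largest norm on `ℤ` below `ℓ` for which `j * g i` has norm at most `φ j`. -/
noncomputable def adjoin (c : ℝ) (hc : 0 < c) (hφ : ∀ j, j ≠ 0 → c ≤ φ j) : AddGroupNorm ℤ where
  toFun x := ⨅ j, ℓ.cost φ g x j
  map_zero' := by
    refine le_antisymm ((ciInf_le (bddBelow_cost ℓ φ g 0) 0).trans ?_)
      (Real.iInf_nonneg fun j => cost_nonneg ..)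
    rw [cost_zero, map_zero]
  add_le' x y := le_ciInf_add_ciInf fun j k =>
    (ciInf_le (bddBelow_cost ℓ φ g _) (j + k)).trans (cost_add_le ..)
  neg' x := by
    rw [← (Equiv.neg (ι → ℤ)).iInf_comp]
    simp [cost_neg]
  eq_zero_of_map_eq_zero' x hx := by
    have h := (le_ciInf fun j => min_le_cost ℓ φ g hφ x j).trans_eq hx
    by_contra h0
    exact absurd h (not_le.mpr (lt_min (map_pos_of_ne_zero ℓ h0) hc))

theorem adjoin_apply (c : ℝ) (hc : 0 < c) (hφ : ∀ j, j ≠ 0 → c ≤ φ j) (x : ℤ) :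
    ℓ.adjoin φ g c hc hφ x = ⨅ j, ℓ.cost φ g x j := rfl

theorem adjoin_le_cost (c : ℝ) (hc : 0 < c) (hφ : ∀ j, j ≠ 0 → c ≤ φ j) (x : ℤ) (j : ι → ℤ) :
    ℓ.adjoin φ g c hc hφ x ≤ ℓ.cost φ g x j :=
  ciInf_le (bddBelow_cost ℓ φ g x) j

theorem adjoin_mul_le (c : ℝ) (hc : 0 < c) (hφ : ∀ j, j ≠ 0 → c ≤ φ j) (j : ℤ) (i : ι) :
    ℓ.adjoin φ g c hc hφ (j * g i) ≤ φ j := by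
  classical
  refine (adjoin_le_cost ℓ φ g c hc hφ _ (Pi.single i j)).trans_eq ?_
  have h1 : ∑ k, (Pi.single i j : ι → ℤ) k * g k = j * g i := by
    rw [Finset.sum_eq_single i] <;> simp +contextual
  have h2 : ∑ k, φ ((Pi.single i j : ι → ℤ) k) = φ j := by
    rw [Finset.sum_eq_single i] <;> simp +contextual
  rw [cost, h1, h2, sub_self, map_zero, zero_add]

end cost

/-- The norm on `ℤ` whose value at `j ≠ 0` is `c * (1 + |j| / J)`. -/
noncomputable def affine (c J : ℝ) (hc : 0 < c) (hJ : 0 < J) : AddGroupNorm ℤ where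
  toFun j := if j = 0 then 0 else c * (1 + |(j : ℝ)| / J)
  map_zero' := by simp
  add_le' x y := by
    have h := fun z : ℤ => (by positivity : 0 ≤ |(z : ℝ)| / J)
    by_cases hx : x = 0
    · simp [hx]
    by_cases hy : y = 0
    · simp [hy]
    rw [if_neg hx, if_neg hy]
    split_ifs
    · have := h x
      have := h y
      positivity
    · have h1 : |((x + y : ℤ) : ℝ)| / J ≤ |(x : ℝ)| / J + |(y : ℝ)| / J := by
        rw [← add_div]
        push_cast
        gcongr
        exact abs_add_le _ _
      nlinarith
  neg' x := by simp
  eq_zero_of_map_eq_zero' x hx := by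
    by_contra h
    rw [if_neg h] at hx
    have : 0 < c * (1 + |(x : ℝ)| / J) := by positivity
    exact this.ne' hx

theorem affine_apply (c J : ℝ) (hc : 0 < c) (hJ : 0 < J) {j : ℤ} (hj : j ≠ 0) :
    affine c J hc hJ j = c * (1 + |(j : ℝ)| / J) := if_neg hj

theorem le_affine (c J : ℝ) (hc : 0 < c) (hJ : 0 < J) (j : ℤ) (hj : j ≠ 0) :
    c ≤ affine c J hc hJ j := by
  rw [affine_apply c J hc hJ hj]
  have : 0 ≤ |(j : ℝ)| / J := by positivity
  nlinarith

theorem affine_le (c J : ℝ) (hc : 0 < c) (hJ : 0 < J) (j : ℤ) (hj : |(j : ℝ)| ≤ J) :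
    affine c J hc hJ j ≤ 2 * c := by
  by_cases h : j = 0
  · rw [h, map_zero]
    positivity
  · rw [affine_apply c J hc hJ h]
    have := div_le_one_of_le₀ hj hJ.le
    nlinarith

theorem abs_le_of_affine_lt_one (c J : ℝ) (hc : 0 < c) (hJ : 0 < J) (j : ℤ)
    (hj : affine c J hc hJ j < 1) : |j| ≤ ⌈J / c⌉ := by
  have h1 : |(j : ℝ)| ≤ J / c := by
    by_cases h : j = 0
    · rw [h]
      simp only [Int.cast_zero, abs_zero]
      positivity
    · rw [affine_apply c J hc hJ h] at hj
      rw [le_div_iff₀ hc]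
      have h2 : |(j : ℝ)| / J * J = |(j : ℝ)| := div_mul_cancel₀ _ hJ.ne'
      nlinarith [mul_lt_mul_of_pos_right hj hJ, mul_pos hc hJ]
  exact_mod_cast h1.trans (Int.le_ceil _)

end AddGroupNorm

/-! ### Distance to `1` on the circle. -/

theorem Circle.dist_eq_norm_sub (x y : Circle) : dist x y = ‖(x : ℂ) - y‖ := dist_eq_norm (x : ℂ) y

theorem Circle.dist_mul_le (x y : Circle) : dist (x * y) 1 ≤ dist x 1 + dist y 1 := by
  have := dist_triangle (x * y) y 1
  have h : dist (x * y) y = dist x 1 := by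
    rw [dist_eq_norm_sub, dist_eq_norm_sub, Circle.coe_mul,
      Circle.coe_one, ← sub_one_mul, norm_mul, Circle.norm_coe, mul_one]
  linarith

theorem Circle.dist_prod_le {ι : Type*} (s : Finset ι) (f : ι → Circle) :
    dist (∏ i ∈ s, f i) 1 ≤ ∑ i ∈ s, dist (f i) 1 := by
  classical
  induction s using Finset.induction_on with
  | empty => simp
  | insert a s ha ih =>
    rw [Finset.prod_insert ha, Finset.sum_insert ha]
    exact (dist_mul_le _ _).trans (by gcongr)

/-- Factor `z ^ 2 - 1 = (z - 1) * (z + 1)`; near `1` the second factor has modulus at least `3 / 2`.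
-/
theorem Circle.dist_one_le_of_dist_sq_one_le {z : Circle} {δ : ℝ} (hz : dist z 1 ≤ 1 / 2)
    (h : dist (z ^ 2) 1 ≤ δ) : dist z 1 ≤ 2 / 3 * δ := by
  rw [dist_eq_norm_sub] at *
  simp only [Circle.coe_pow, Circle.coe_one] at *
  have h1 : ‖(z : ℂ) ^ 2 - 1‖ = ‖(z : ℂ) - 1‖ * ‖(z : ℂ) + 1‖ := by
    rw [← norm_mul]
    congr 1
    ring
  have h2 : 3 / 2 ≤ ‖(z : ℂ) + 1‖ := by
    have h3 := norm_sub_norm_le (2 : ℂ) (1 - z)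
    rw [norm_sub_rev 1, show (2 : ℂ) - (1 - z) = z + 1 by ring] at h3
    norm_num at h3
    linarith
  nlinarith [norm_nonneg ((z : ℂ) - 1)]

theorem Circle.dist_one_le_of_dist_pow_two_pow {z : Circle} (R : ℕ)
    (h : ∀ r ≤ R, dist (z ^ 2 ^ r) 1 ≤ 1 / 2) : dist z 1 ≤ (2 / 3) ^ R := by
  induction R generalizing z with
  | zero =>
    have := h 0 le_rfl
    simp only [pow_zero, pow_one] at this ⊢
    linarith
  | succ R ih =>
    have h1 := ih (z := z ^ 2) fun r hr => by
      rw [← pow_mul, ← pow_succ']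
      exact h (r + 1) (by omega)
    have h0 := h 0 (by omega)
    rw [pow_zero, pow_one] at h0
    rw [pow_succ']
    exact dist_one_le_of_dist_sq_one_le h0 h1

/-! ### Construction of the norm and of the null sequence. -/

/-- Boundedness of the unit ball is the invariant of the recursion: it allows the next `g` to be
sparse relative to that ball. -/
theorem AddGroupNorm.exists_smaller (ℓ : AddGroupNorm ℤ) (hℓ : ∃ M : ℤ, ∀ x, ℓ x < 1 → |x| ≤ M)
    (n : ℕ) :
    ∃ (ℓ' : AddGroupNorm ℤ) (B : Finset ℤ), (∃ M : ℤ, ∀ x, ℓ' x < 1 → |x| ≤ M) ∧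
      (∀ x, ℓ' x ≤ ℓ x) ∧ (∀ x : ℤ, |x| ≤ n → min (ℓ x) 1 ≤ ℓ' x) ∧ B.Nonempty ∧
      (∀ b ∈ B, ℓ' b ≤ 2 * (1 / ((n : ℝ) + 1))) ∧
      ∀ z : Circle, (∀ b ∈ B, dist (z ^ b) 1 ≤ 1 / 2) → dist z 1 ≤ 1 / ((n : ℝ) + 1) := by
  obtain ⟨M, hM⟩ := hℓ
  set c : ℝ := 1 / ((n : ℝ) + 1) with hc_def
  have hc : 0 < c := by positivity
  -- The product of `n + 1 = 1 / c` factors, each within `c * c` of `1`, is within `c` of `1`.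
  obtain ⟨R, hR⟩ : ∃ R : ℕ, ((2 : ℝ) / 3) ^ R < c * c :=
    exists_pow_lt_of_lt_one (by positivity) (by norm_num)
  have hJ : (0 : ℝ) < 2 ^ R := by positivity
  -- The floor `c` charges every nonzero coefficient; the slope is small enough that `2 ^ r` with `r
  -- ≤ R` costs at most `2 * c`, yet it bounds by `L` the coefficients costing less than `1`.
  set φ := affine c (2 ^ R) hc hJ
  set L : ℤ := ⌈2 ^ R / c⌉
  have hφL : ∀ j, φ j < 1 → |j| ≤ L := abs_le_of_affine_lt_one c _ hc hJ
  obtain ⟨g, hg1, hg⟩ := exists_lacunary_sum_eq_one n L (M + n)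
  have hcost : ∀ x j, ℓ.cost φ g x j < 1 → |x - ∑ i, j i * g i| ≤ M ∧ ∀ i, |j i| ≤ L := by
    intro x j h
    have h1 : 0 ≤ ∑ i, φ (j i) := Finset.sum_nonneg fun _ _ => apply_nonneg _ _
    have h2 : 0 ≤ ℓ (x - ∑ i, j i * g i) := apply_nonneg _ _
    unfold cost at h
    refine ⟨hM _ (by linarith), fun i => hφL _ ?_⟩
    have := Finset.single_le_sum (f := fun i => φ (j i)) (fun i _ => apply_nonneg φ (j i))
      (Finset.mem_univ i)
    linarith
  refine ⟨ℓ.adjoin φ g c hc (le_affine c _ hc hJ),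
    (Finset.univ ×ˢ Finset.range (R + 1)).image fun p => 2 ^ p.2 * g p.1,
    ⟨M + ∑ i, L * |g i|, fun x hx => ?_⟩, fun x => ?_, fun x hx => le_ciInf fun j => ?_,
    ?_, fun b hb => ?_, fun z hz => ?_⟩
  · obtain ⟨j, hj⟩ := exists_lt_of_ciInf_lt hx
    obtain ⟨h1, h2⟩ := hcost x j hj
    have h3 : |∑ i, j i * g i| ≤ ∑ i, L * |g i| := by
      refine (Finset.abs_sum_le_sum_abs _ _).trans (Finset.sum_le_sum fun i _ => ?_)
      rw [abs_mul]
      exact mul_le_mul_of_nonneg_right (h2 i) (abs_nonneg _)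
    have := abs_add_le (x - ∑ i, j i * g i) (∑ i, j i * g i)
    rw [sub_add_cancel] at this
    linarith
  · exact (adjoin_le_cost ℓ φ g c hc _ x 0).trans_eq (cost_zero ..)
  · by_contra! hlt
    obtain ⟨h1, h2⟩ := hcost x j (hlt.trans_le (min_le_right _ _))
    have h3 := hg j h2 (by
      have := abs_sub x (x - ∑ i, j i * g i)
      rw [sub_sub_cancel] at this
      linarith)
    by_cases h0 : j 0 = 0
    · have : j = 0 := funext fun i => (h3 i).trans h0
      rw [this, cost_zero] at hlt
      exact absurd (min_le_left (ℓ x) 1) (not_le.mpr hlt)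
    -- All `n + 1` coefficients equal `j 0 ≠ 0`, so together they cost at least `(n + 1) * c = 1`.
    · have h4 : ∑ _i : Fin (n + 1), c ≤ ∑ i, φ (j i) :=
        Finset.sum_le_sum fun i _ => le_affine c _ hc hJ _ (by rwa [h3 i])
      have h5 : ∑ _i : Fin (n + 1), c = 1 := by
        simp only [Finset.sum_const, Finset.card_univ, Fintype.card_fin, nsmul_eq_mul, hc_def]
        push_cast
        field_simp
      have h6 := apply_nonneg ℓ (x - ∑ i, j i * g i)
      have h7 := min_le_right (ℓ x) 1
      unfold cost at hlt
      linarith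
  · simp
  · simp only [Finset.mem_image, Finset.mem_product, Finset.mem_univ, true_and, Finset.mem_range,
      Prod.exists] at hb
    obtain ⟨i, r, hr, rfl⟩ := hb
    refine (adjoin_mul_le ℓ φ g c hc _ (2 ^ r) i).trans (affine_le c _ hc hJ _ ?_)
    push_cast
    rw [abs_of_pos (by positivity)]
    exact pow_le_pow_right₀ one_le_two (by omega)
  · have h1 : ∀ i, dist (z ^ g i) 1 ≤ c * c := fun i => by
      refine (Circle.dist_one_le_of_dist_pow_two_pow R fun r hr => ?_).trans hR.le
      have := hz (2 ^ r * g i) (Finset.mem_image_of_mem (fun p => 2 ^ p.2 * g p.1) (a := (i, r))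
        (by simp; omega))
      rwa [mul_comm, zpow_mul, show (2 : ℤ) ^ r = ((2 ^ r : ℕ) : ℤ) by push_cast; rfl,
        zpow_natCast] at this
    have h2 : z = ∏ i, z ^ g i := by
      have := (map_sum (zmultiplesHom (Additive Circle) (Additive.ofMul z)) g Finset.univ)
      rw [hg1] at this
      simpa using congrArg Additive.toMul this
    rw [h2]
    refine (Circle.dist_prod_le _ _).trans ((Finset.sum_le_sum fun i _ => h1 i).trans_eq ?_)
    simp only [Finset.sum_const, Finset.card_univ, Fintype.card_fin, nsmul_eq_mul, hc_def]
    push_cast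
    field_simp

/-- The infimum is definite because from stage `m ≥ |x|` on the value at `x` never drops below `min
(ℓ m x) 1`. -/
theorem AddGroupNorm.exists_iInf (ℓ : ℕ → AddGroupNorm ℤ) (hanti : ∀ n x, ℓ (n + 1) x ≤ ℓ n x)
    (hmin : ∀ (n : ℕ) (x : ℤ), |x| ≤ n → min (ℓ n x) 1 ≤ ℓ (n + 1) x) :
    ∃ N : AddGroupNorm ℤ, ∀ n x, N x ≤ ℓ n x := by
  have hbdd : ∀ x, BddBelow (Set.range fun n => ℓ n x) := fun x =>
    ⟨0, by rintro _ ⟨n, rfl⟩; exact apply_nonneg _ _⟩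
  have hA : ∀ x, Antitone fun n => ℓ n x := fun x => antitone_nat_of_succ_le fun n => hanti n x
  refine ⟨{ toFun := fun x => ⨅ n, ℓ n x
            map_zero' := by simp
            add_le' := fun x y => le_ciInf_add_ciInf fun i j => ?_
            neg' := fun x => by simp [map_neg_eq_map]
            eq_zero_of_map_eq_zero' := fun x hx => ?_ }, fun n x => ciInf_le (hbdd x) n⟩
  · refine (ciInf_le (hbdd _) (max i j)).trans ((map_add_le_add _ _ _).trans ?_)
    exact add_le_add (hA x (le_max_left i j)) (hA y (le_max_right i j))
  · by_contra h0
    obtain ⟨m, hm⟩ : ∃ m : ℕ, |x| ≤ m := ⟨x.natAbs, by simp⟩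
    have hpos : 0 < min (ℓ m x) 1 := lt_min (map_pos_of_ne_zero _ h0) one_pos
    have hlow : ∀ k, min (ℓ m x) 1 ≤ ℓ (m + k) x := by
      intro k
      induction k with
      | zero => exact min_le_left _ _
      | succ k ih =>
        exact (le_min ih (min_le_right _ _)).trans
          (hmin (m + k) x (hm.trans (by exact_mod_cast Nat.le_add_right m k)))
    refine absurd (hpos.trans_le (le_ciInf fun n => ?_)) (not_lt.mpr hx.le)
    exact (hlow n).trans (hA x (Nat.le_add_left n m))

theorem AddGroupNorm.exists_lt_one_imp_abs_le :
    ∃ ℓ : AddGroupNorm ℤ, ∃ M : ℤ, ∀ x, ℓ x < 1 → |x| ≤ M := by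
  refine ⟨{ toFun := fun x => |(x : ℝ)|
            map_zero' := by simp
            add_le' := fun x y => by push_cast; exact abs_add_le _ _
            neg' := fun x => by simp
            eq_zero_of_map_eq_zero' := fun x hx => by simpa using hx }, 1, fun x hx => ?_⟩
  change |(x : ℝ)| < 1 at hx
  exact_mod_cast hx.le

/-- There is a sequence of integers, converging to zero in some Hausdorff group topology on `ℤ`,
which characterizes the trivial subgroup of the circle. -/
theorem AddGroupNorm.exists_tendsto_zero_characterizing_one :
    ∃ (N : AddGroupNorm ℤ) (v : ℕ → ℤ), Tendsto (fun n => N (v n)) atTop (𝓝 0) ∧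
      ∀ z : Circle, Tendsto (fun n => z ^ v n) atTop (𝓝 1) → z = 1 := by
  choose! next block hnext hle hmin hne hblock hz using AddGroupNorm.exists_smaller
  obtain ⟨ℓ₀, hℓ₀⟩ := AddGroupNorm.exists_lt_one_imp_abs_le
  let ℓ : ℕ → AddGroupNorm ℤ := fun n => Nat.rec ℓ₀ (fun n l => next l n) n
  have hℓ : ∀ n, ∃ M : ℤ, ∀ x, ℓ n x < 1 → |x| ≤ M := by
    intro n
    induction n with
    | zero => exact hℓ₀
    | succ n ih => exact hnext _ ih n
  obtain ⟨N, hN⟩ := AddGroupNorm.exists_iInf ℓ (fun n => hle _ (hℓ n) n)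
    (fun n => hmin _ (hℓ n) n)
  let B : ℕ → Finset ℤ := fun n => block (ℓ n) n
  have hB : ∀ n, ∀ b ∈ B n, N b ≤ 2 * (1 / ((n : ℝ) + 1)) := fun n b hb =>
    (hN (n + 1) b).trans (hblock _ (hℓ n) n b hb)
  have : ∀ n, Nonempty (B n) := fun n => (hne _ (hℓ n) n).to_subtype
  have : Infinite (Σ n, B n) :=
    Infinite.of_surjective Sigma.fst fun n => ⟨⟨n, Classical.arbitrary _⟩, rfl⟩
  obtain ⟨e⟩ : Nonempty (ℕ ≃ Σ n, B n) := nonempty_equiv_of_countable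
  -- Blocks are finite, so any enumeration of their disjoint union leaves each block for good.
  have hfst : Tendsto (fun n => (e n).1) atTop atTop := by
    rw [← Nat.cofinite_eq_atTop]
    refine Tendsto.comp ?_ e.injective.tendsto_cofinite
    refine Tendsto.cofinite_of_finite_preimage_singleton fun n => ?_
    refine (Set.finite_range fun b : B n => (⟨n, b⟩ : Σ n, B n)).subset ?_
    rintro ⟨m, b⟩ rfl
    exact ⟨b, rfl⟩
  refine ⟨N, fun n => (e n).2, ?_, fun z h => ?_⟩
  · have h1 : Tendsto (fun n : ℕ => 2 * (1 / ((n : ℝ) + 1))) atTop (𝓝 0) := by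
      simpa using (tendsto_one_div_add_atTop_nhds_zero_nat (𝕜 := ℝ)).const_mul 2
    exact squeeze_zero (fun n => apply_nonneg _ _) (fun n => hB _ _ (e n).2.2) (h1.comp hfst)
  · have h1 : ∀ᶠ n in atTop, dist (z ^ ((e n).2 : ℤ)) 1 ≤ 1 / 2 :=
      (h.eventually (Metric.closedBall_mem_nhds (1 : Circle) (by norm_num : (0 : ℝ) < 1 / 2)))
    obtain ⟨n₀, hn₀⟩ := eventually_atTop.mp h1
    have h2 : ∀ᶠ k : ℕ in atTop, dist z 1 ≤ 1 / ((k : ℝ) + 1) := by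
      -- The first `n₀` terms meet only blocks below `K`; every later block lies wholly in the range
      -- where `z ^ v n` is within `1 / 2` of `1`.
      obtain ⟨K, hK⟩ := ((Finset.range n₀).image fun n => (e n).1).exists_nat_subset_range
      filter_upwards [eventually_ge_atTop K] with k hk
      refine hz _ (hℓ k) k z fun b hb => ?_
      have h4 : n₀ ≤ e.symm ⟨k, b, hb⟩ := by
        by_contra! hlt
        have := hK (Finset.mem_image_of_mem _ (Finset.mem_range.mpr hlt))
        simp only [Equiv.apply_symm_apply, Finset.mem_range] at this
        omega
      have h5 := hn₀ _ h4
      rwa [e.apply_symm_apply] at h5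
    have h3 := ge_of_tendsto (tendsto_one_div_add_atTop_nhds_zero_nat (𝕜 := ℝ)) h2
    exact dist_le_zero.mp h3

/-! ### T-sequences from norms. -/

theorem GroupNorm.isTSequence {G : Type*} [CommGroup G] (N : GroupNorm G) {u : ℕ → G}
    (hu : Tendsto (fun n => N (u n)) atTop (𝓝 0)) : IsTSequence u := by
  let := N.toNormedCommGroup
  refine ⟨⟨inferInstance, inferInstance⟩, inferInstance, ?_⟩
  exact tendsto_one_iff_norm_tendsto_zero.mpr hu

/-- Transport along an injective homomorphism preserves convergence in norm. -/
theorem AddGroupNorm.isTSequence_of_injective {G : Type*} [CommGroup G] (N : AddGroupNorm ℤ)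
    {v : ℕ → ℤ} (hv : Tendsto (fun n => N (v n)) atTop (𝓝 0)) (χ : G)
    (hχ : Function.Injective fun n : ℤ => χ ^ n) : IsTSequence fun n => χ ^ v n := by
  classical
  -- Truncating at `1` allows the constant value `1` off the cyclic subgroup: if `x` or `y` lies
  -- outside, the bound for `x * y` is at least `1`.
  let f : G → ℝ := fun x => if h : ∃ n : ℤ, χ ^ n = x then min (N h.choose) 1 else 1
  have hf : ∀ n : ℤ, f (χ ^ n) = min (N n) 1 := fun n => by
    have h : ∃ k : ℤ, χ ^ k = χ ^ n := ⟨n, rfl⟩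
    change dite _ _ _ = _
    rw [dif_pos h, hχ h.choose_spec]
  have hf1 : ∀ x, (¬ ∃ n : ℤ, χ ^ n = x) → f x = 1 := fun x h => dif_neg h
  have hle : ∀ x, f x ≤ 1 := fun x => by
    by_cases h : ∃ n : ℤ, χ ^ n = x
    · obtain ⟨n, rfl⟩ := h
      exact (hf n).trans_le (min_le_right _ _)
    · exact (hf1 x h).le
  have h0 : ∀ x, 0 ≤ f x := fun x => by
    by_cases h : ∃ n : ℤ, χ ^ n = x
    · obtain ⟨n, rfl⟩ := h
      rw [hf]
      exact le_min (apply_nonneg _ _) zero_le_one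
    · exact zero_le_one.trans (hf1 x h).ge
  let F : GroupNorm G :=
    { toFun := f
      map_one' := by
        have := hf 0
        rwa [zpow_zero, map_zero, min_eq_left zero_le_one] at this
      mul_le' := fun x y => by
        by_cases hx : ∃ n : ℤ, χ ^ n = x
        · by_cases hy : ∃ n : ℤ, χ ^ n = y
          · obtain ⟨m, rfl⟩ := hx
            obtain ⟨n, rfl⟩ := hy
            rw [← zpow_add, hf, hf, hf]
            have h1 := map_add_le_add N m n
            have h2 := apply_nonneg N m
            have h3 := apply_nonneg N n
            rcases le_total (N m) 1 with h4 | h4 <;> rcases le_total (N n) 1 with h5 | h5 <;>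
              simp only [h4, h5, min_eq_left, min_eq_right, min_le_iff]
            · exact Or.inl h1
            all_goals exact Or.inr (by linarith)
          · have := hf1 y hy
            linarith [hle (x * y), h0 x]
        · have := hf1 x hx
          linarith [hle (x * y), h0 y]
      inv' := fun x => by
        by_cases hx : ∃ n : ℤ, χ ^ n = x
        · obtain ⟨n, rfl⟩ := hx
          rw [← zpow_neg, hf, hf, map_neg_eq_map]
        · have hx' : ¬ ∃ n : ℤ, χ ^ n = x⁻¹ := fun ⟨n, hn⟩ => hx ⟨-n, by rw [zpow_neg, hn, inv_inv]⟩
          rw [hf1 x hx, hf1 _ hx']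
      eq_one_of_map_eq_zero' := fun x hx => by
        by_cases h : ∃ n : ℤ, χ ^ n = x
        · obtain ⟨n, rfl⟩ := h
          rw [hf] at hx
          have hn : N n = 0 := by
            rcases min_choice (N n) 1 with h | h <;> rw [h] at hx
            · exact hx
            · exact absurd hx one_ne_zero
          have : n = 0 := by
            by_contra hne
            exact (map_pos_of_ne_zero N hne).ne' hn
          rw [this, zpow_zero]
        · rw [hf1 x h] at hx
          exact absurd hx one_ne_zero }
  refine F.isTSequence (squeeze_zero (fun n => h0 _) (fun n => ?_) hv)
  exact (hf (v n)).trans_le (min_le_left _ _)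

/-! ### Subgroups and characters of the circle. -/

/-- On `ℝ / ℤ`, a subgroup that is not dense is generated by an element of finite order, hence
finite. -/
theorem Circle.dense_of_infinite {H : Subgroup Circle} (hH : (H : Set Circle).Infinite) :
    Dense (H : Set Circle) := by
  have : Fact ((0 : ℝ) < 1) := ⟨one_pos⟩
  let e := AddCircle.homeomorphCircle (one_ne_zero : (1 : ℝ) ≠ 0)
  let s : AddSubgroup (AddCircle (1 : ℝ)) :=
    { carrier := e ⁻¹' H
      zero_mem' := by
        change e 0 ∈ H
        rw [AddCircle.homeomorphCircle_apply, AddCircle.toCircle_zero]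
        exact H.one_mem
      add_mem' := fun {x y} hx hy => by
        have := H.mul_mem hx hy
        rwa [AddCircle.homeomorphCircle_apply, AddCircle.homeomorphCircle_apply,
          ← AddCircle.toCircle_add, ← AddCircle.homeomorphCircle_apply one_ne_zero] at this
      neg_mem' := fun {x} hx => by
        have := H.inv_mem hx
        rwa [AddCircle.homeomorphCircle_apply,
          ← AddCircle.toCircle_neg, ← AddCircle.homeomorphCircle_apply one_ne_zero] at this }
  have hs : Dense (s : Set (AddCircle (1 : ℝ))) := by
    refine AddCircle.dense_addSubgroup_iff_ne_zmultiples.mpr fun a ha h => ?_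
    have h1 : (s : Set (AddCircle (1 : ℝ))).Infinite :=
      hH.preimage (by simp [e.surjective.range_eq])
    rw [h] at h1
    exact h1 (addOrderOf_ne_zero_iff.mp ha).finite_zmultiples
  have h2 := e.surjective.denseRange.dense_image e.continuous hs
  rwa [show (s : Set (AddCircle (1 : ℝ))) = e ⁻¹' H from rfl,
    Set.image_preimage_eq _ e.surjective] at h2

/-- By Lagrange the elements of `H` are roots of unity of order dividing `Nat.card H`, and there are
at most `Nat.card H` of these in `ℂ`. -/
theorem Circle.mem_iff_pow_card_eq_one {H : Subgroup Circle} [Finite H] (z : Circle) :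
    z ∈ H ↔ z ^ Nat.card H = 1 := by
  have : NeZero (Nat.card H) := ⟨Nat.card_pos.ne'⟩
  constructor
  · intro hz
    exact congrArg Subtype.val (pow_card_eq_one' (x := (⟨z, hz⟩ : H)))
  · intro hz
    let R : Set ℂ := {w | w ^ Nat.card H = 1}
    have hR : R.Finite ∧ R.ncard ≤ Nat.card H := by
      have : R = (Polynomial.nthRoots (Nat.card H) (1 : ℂ)).toFinset := by
        ext w
        simp [R, Polynomial.mem_nthRoots Nat.card_pos]
      rw [this]
      refine ⟨Finset.finite_toSet _, ?_⟩
      rw [Set.ncard_coe_finset]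
      exact (Multiset.toFinset_card_le _).trans (Polynomial.card_nthRoots _ _)
    have hsub : (fun x : Circle => (x : ℂ)) '' H ⊆ R := by
      rintro _ ⟨x, hx, rfl⟩
      have := congrArg Subtype.val (pow_card_eq_one' (x := (⟨x, hx⟩ : H)))
      change (x : ℂ) ^ Nat.card H = 1
      exact_mod_cast congrArg (fun c : Circle => (c : ℂ)) this
    have hcard : ((fun x : Circle => (x : ℂ)) '' H).ncard = Nat.card H := by
      exact Set.ncard_image_of_injective _ Circle.coe_injective
    have heq := Set.eq_of_subset_of_ncard_le hsub (hR.2.trans hcard.ge) hR.1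
    have hzR : (z : ℂ) ∈ R := by
      change (z : ℂ) ^ Nat.card H = 1
      exact_mod_cast congrArg (fun c : Circle => (c : ℂ)) hz
    rw [← heq] at hzR
    obtain ⟨x, hx, hxz⟩ := hzR
    rwa [← Circle.coe_injective hxz]

/-- The topology is pointwise convergence on `s_u`: convergence of `u` holds by definition of `s_u`,
and density makes restriction to `s_u` injective, hence the topology Hausdorff. -/
theorem PontryaginDual.isTSequence_of_dense {X : Type*} [CommGroup X] [TopologicalSpace X]
    (u : ℕ → PontryaginDual X) (hu : Dense (sSubgroup u : Set X)) : IsTSequence u := by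
  let H : Set X := sSubgroup u
  let ev : PontryaginDual X →* (H → Circle) :=
    { toFun := fun χ x => χ x
      map_one' := rfl
      map_mul' := fun _ _ => rfl }
  let τ : TopologicalSpace (PontryaginDual X) := TopologicalSpace.induced ev inferInstance
  have hτ : @IsTopologicalGroup _ τ _ := topologicalGroup_induced ev
  have hinj : Function.Injective ev := fun χ ψ h => DFunLike.coe_injective <|
    Continuous.ext_on hu (map_continuous χ) (map_continuous ψ) fun x hx => congrFun h ⟨x, hx⟩
  refine ⟨⟨τ, hτ⟩, ?_, ?_⟩
  · exact @T2Space.of_injective_continuous _ _ τ _ _ ev hinj continuous_induced_dom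
  · change Tendsto u atTop (@nhds _ τ 1)
    rw [nhds_induced, tendsto_comap_iff]
    exact tendsto_pi_nhds.mpr fun x => x.2

/-- The character `z ↦ z ^ m` of the circle. -/
noncomputable def Circle.powCharacter (m : ℕ) : PontryaginDual Circle :=
  ({ powMonoidHom m with continuous_toFun := continuous_pow m } : Circle →ₜ* Circle)

theorem Circle.powCharacter_apply (m : ℕ) (z : Circle) : powCharacter m z = z ^ m := rfl

theorem Circle.powCharacter_zpow_apply (m : ℕ) (n : ℤ) (z : Circle) :
    (powCharacter m ^ n) z = (z ^ m) ^ n := by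
  let ev : PontryaginDual Circle →* Circle :=
    { toFun := fun χ => χ z
      map_one' := rfl
      map_mul' := fun _ _ => rfl }
  exact map_zpow ev _ n

theorem Circle.powCharacter_zpow_injective {m : ℕ} (hm : m ≠ 0) :
    Function.Injective fun n : ℤ => powCharacter m ^ n := by
  refine injective_zpow_iff_not_isOfFinOrder.mpr fun h => ?_
  obtain ⟨n, hn, h1⟩ := isOfFinOrder_iff_pow_eq_one.mp h
  -- At this point the power `m * n` takes the value `-1`, so the character is not trivial.
  have h2 := congrArg (fun χ : PontryaginDual Circle => χ (Circle.exp (Real.pi / (m * n)))) h1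
  have h3 := powCharacter_zpow_apply m n (Circle.exp (Real.pi / (m * n)))
  rw [zpow_natCast, zpow_natCast, ← pow_mul] at h3
  have h4 : Circle.exp (Real.pi / (m * n)) ^ (m * n) = 1 := h3.symm.trans h2
  have h5 := congrArg (fun c : Circle => (c : ℂ)) h4
  simp only [Circle.coe_pow, Circle.coe_exp, Circle.coe_one, ← Complex.exp_nat_mul] at h5
  have h6 : ((m * n : ℕ) : ℂ) * (((Real.pi / (m * n) : ℝ) : ℂ) * Complex.I)
      = Real.pi * Complex.I := by
    have : (m : ℂ) ≠ 0 := by exact_mod_cast hm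
    have : (n : ℂ) ≠ 0 := by exact_mod_cast hn.ne'
    push_cast
    field_simp
  rw [h6, Complex.exp_pi_mul_I] at h5
  norm_num at h5

theorem proposition3p4 : tCharSubgroups Circle = charSubgroups Circle := by
  refine Set.Subset.antisymm (fun H ⟨u, _, hu⟩ => ⟨u, hu⟩) ?_
  rintro _ ⟨u, rfl⟩
  rcases (sSubgroup u : Set Circle).finite_or_infinite with hfin | hinf
  · have : Finite (sSubgroup u) := hfin
    set m := Nat.card (sSubgroup u)
    obtain ⟨N, v, hv, hz⟩ := AddGroupNorm.exists_tendsto_zero_characterizing_one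
    refine ⟨fun n => Circle.powCharacter m ^ v n, N.isTSequence_of_injective hv _
      (Circle.powCharacter_zpow_injective Nat.card_pos.ne'), ?_⟩
    ext z
    rw [Circle.mem_iff_pow_card_eq_one]
    change _ ↔ Tendsto (fun n => (Circle.powCharacter m ^ v n) z) atTop (𝓝 1)
    simp only [Circle.powCharacter_zpow_apply]
    refine ⟨fun h => ?_, hz _⟩
    rw [h]
    simp
  · exact ⟨u, PontryaginDual.isTSequence_of_dense u (Circle.dense_of_infinite hinf), rfl⟩
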